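/- Let $N\ge 2$ and let $\Omega\subset\mathbb{R}$ be a bounded open convex set. Let $\varphi_1,\dots,\varphi_N\colon\Omega\to\mathbb{R}$ be injective $C^1$-maps whose derivatives vanish nowhere on $\Omega$ and are Hölder continuous on $\Omega$ (that is, $|\varphi_i'(x)-\varphi_i'(y)|\le c|x-y|^{\alpha}$ for all $x,y\in\Omega$, for some $\alpha,c>0$), such that $\overline{\varphi_i(\Omega)}\subset\Omega$ and $\|\varphi_i'\|:=\sup_{x\in\Omega}|\varphi_i'(x)|<1$ for all $i$. Let $F\subset\Omega$ be the associated self-conformal set, i.e. the non-empty compact set with $F=\bigcup_{i=1}^N\varphi_i(F)$, and suppose that $F$ contains at least two points. For a finite word $\mathtt{i}=i_1\cdots i_n$ over $\{1,\dots,N\}$ write $\varphi_{\mathtt{i}}=\varphi_{i_1}\circ\cdots\circ\varphi_{i_n}$ (the identity for the empty word) and $\|\varphi_{\mathtt i}'\|=\sup_{x\in\Omega}|\varphi_{\mathtt i}'(x)|$. Suppose that $F$ does not satisfy the identity limit criterion, i.e. that it is not the case that $$\inf\Bigl\{\|\varphi_{\mathtt i}'\|^{-1}\sup_{x\in F}|\varphi_{\mathtt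 i}(x)-\varphi_{\mathtt j}(x)| : \mathtt i,\mathtt j \text{ finite words with } \varphi_{\mathtt i}|_F\ne\varphi_{\mathtt j}|_F\Bigr\}>0 .$$ Then $[-1,1]$ is a weak tangent of $F$, i.e. there are $x_n\in\mathbb{R}$ and $r_n>0$ such that the sets $\bigl\{(z-x_n)/r_n : z\in F\bigr\}\cap[-1,1]$ converge to $[-1,1]$ in Hausdorff distance as $n\to\infty$; and the Assouad dimension of $F$ equals $1$. Here the Assouad dimension of $A\subset\mathbb{R}$ is the infimum of all $s\ge 0$ for which there is a constant $C\ge 1$ such that, for all $x \in \mathbb{R}$ and $0<r<R$, the set $A\cap B(x,R)$ can be covered by at most $C(R/r)^s$ closed balls of radius $r$ centred in $A$, where $B(x,R)$ is the closed ball. -/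

import Mathlib

open Set Filter Topology
open scoped NNReal ENNReal

namespace SelfConformal

noncomputable section

/-- A map `f` is conformal on an open set `Ω ⊆ ℝ`: it is continuously differentiable with nowhere
vanishing derivative, and the derivative is Hölder continuous on `Ω`. (On the real line, a linear
map is a similarity exactly when it is non-zero.) Only the values of `f` on `Ω` matter. -/
structure IsConformalOn (f : ℝ → ℝ) (Ω : Set ℝ) : Prop where
  contDiffOn : ContDiffOn ℝ 1 f Ω
  deriv_ne_zero : ∀ x ∈ Ω, deriv f x ≠ 0
  holder : ∃ α > (0 : ℝ), ∃ c > (0 : ℝ), ∀ x ∈ Ω, ∀ y ∈ Ω,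
    |deriv f x - deriv f y| ≤ c * |x - y| ^ α

/-- The supremum norm `‖f'‖ = sup_{x ∈ Ω} |f'(x)|` of the derivative. -/
def derivNorm (Ω : Set ℝ) (f : ℝ → ℝ) : ℝ := ⨆ x : Ω, |deriv f x|

/-- `φ` is a conformal iterated function system of `N ≥ 2` maps on the bounded open convex
set `Ω ⊆ ℝ`. Since the derivatives are Hölder continuous on the bounded set `Ω`, they are bounded,
so `derivNorm` is a genuine supremum (whenever `Ω` is non-empty). -/
structure IsConformalIFS {N : ℕ} (Ω : Set ℝ) (φ : Fin N → ℝ → ℝ) : Prop where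
  two_le : 2 ≤ N
  isOpen : IsOpen Ω
  isBounded : Bornology.IsBounded Ω
  convex : Convex ℝ Ω
  conformal : ∀ i, IsConformalOn (φ i) Ω
  injOn : ∀ i, InjOn (φ i) Ω
  closure_image_subset : ∀ i, closure (φ i '' Ω) ⊆ Ω
  derivNorm_lt_one : ∀ i, derivNorm Ω (φ i) < 1

/-- `F` is the self-conformal set of the system `φ` on `Ω`: the non-empty compact subset of `Ω`
with `F = ⋃ i, φ i (F)`. -/
structure IsSelfConformalSet {N : ℕ} (Ω : Set ℝ) (φ : Fin N → ℝ → ℝ) (F : Set ℝ) : Prop where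
  ifs : IsConformalIFS Ω φ
  nonempty : F.Nonempty
  isCompact : IsCompact F
  subset : F ⊆ Ω
  eq_iUnion : F = ⋃ i, φ i '' F

/-- `φ_w = φ_{w₁} ∘ ⋯ ∘ φ_{wₙ}` for a finite word `w = w₁ ⋯ wₙ`; the empty word gives the
identity. -/
def wordMap {N : ℕ} (φ : Fin N → ℝ → ℝ) : List (Fin N) → ℝ → ℝ
  | [] => id
  | i :: w => φ i ∘ wordMap φ w

/-- The identity limit criterion: the infimum of `‖φ_v'‖⁻¹ * sup_{x ∈ F} |φ_v x - φ_w x|` over all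
pairs of finite words `v`, `w` with `φ_v|_F ≠ φ_w|_F` is positive. The infimum is taken in
`[0, ∞]`. -/
def IdentityLimitCriterion {N : ℕ} (Ω : Set ℝ) (φ : Fin N → ℝ → ℝ) (F : Set ℝ) : Prop :=
  0 < ⨅ (v : List (Fin N)) (w : List (Fin N))
      (_ : F.domRestrict (wordMap φ v) ≠ F.domRestrict (wordMap φ w)),
    ENNReal.ofReal ((derivNorm Ω (wordMap φ v))⁻¹ * ⨆ x : F, |wordMap φ v x - wordMap φ w x|)

/-- `s` is an admissible exponent for the Assouad dimension of `A`: for some `C ≥ 1`, each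
`A ∩ B(x, R)` can be covered by at most `C (R / r) ^ s` balls of radius `r` centred in `A`,
for all `0 < r < R`. -/
def IsAssouadExponent (A : Set ℝ) (s : ℝ≥0) : Prop :=
  ∃ C : ℝ, 1 ≤ C ∧ ∀ (x r R : ℝ), 0 < r → r < R →
    ∃ t : Finset ℝ, (t : Set ℝ) ⊆ A ∧ (t.card : ℝ) ≤ C * (R / r) ^ (s : ℝ) ∧
      A ∩ Metric.closedBall x R ⊆ ⋃ y ∈ t, Metric.closedBall y r

/-- The Assouad dimension of `A ⊆ ℝ`: the infimum, in `[0, ∞]`, of the admissible exponents. -/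
def assouadDim (A : Set ℝ) : ℝ≥0∞ :=
  ⨅ (s : ℝ≥0) (_ : IsAssouadExponent A s), (s : ℝ≥0∞)

/-- The magnification `z ↦ (z - x) / r`. -/
def magnification (x r : ℝ) (z : ℝ) : ℝ := (z - x) / r

/-- `T ⊆ [-1, 1]` is a weak tangent of `E`: for some points `xₙ` and scales `rₙ > 0`, the sets
`M_{xₙ, rₙ}(E) ∩ [-1, 1]` converge to `T` in Hausdorff distance. (The extended distance is used
because it is `∞` between an empty and a non-empty set.) -/
def IsWeakTangent (E T : Set ℝ) : Prop :=
  T ⊆ Icc (-1) 1 ∧ ∃ (x r : ℕ → ℝ), (∀ n, 0 < r n) ∧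
    Tendsto (fun n => Metric.hausdorffEDist (magnification (x n) (r n) '' E ∩ Icc (-1) 1) T)
      atTop (𝓝 0)

end

end SelfConformal

namespace SelfConformal

/-! ### Derivatives and distortion of word maps -/

section Words

variable {N : ℕ} {Ω : Set ℝ} {φ : Fin N → ℝ → ℝ} {F : Set ℝ}

/-! Failure of the criterion gives words `v`, `w` whose maps differ on `F`, but by arbitrarily
little relative to the derivative of `φ_v`. Let `δ` be the largest value of `|φ_v - φ_w|` on `F`,
attained at `z`. Near `z` both maps are almost affine. Their slopes almost agree, since otherwise
the difference would exceed `δ` at another point of `F`. Hence, on a cylinder `u` with `z ∈ φ_u(F)`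
and `φ_{vu}(F)` of size about `δ`, the map `φ_{wu}` is nearly `φ_{vu}` shifted by a constant of size
`δ` (`exists_difference_variation_le`, `exists_cylinder`).

Such shifts lengthen dense pieces. If `F` is dense in a piece at the scale of a reference pair, move
the piece by `φ_{vu}` and append the gap from `φ_{vu}(M)` to `φ_{wu}(M)`, where `M` is the end
facing the shift. This gap is comparable to the new reference scale, so the relative length grows by
a fixed `κ` (`exists_hasDensePiece_add`). The induction closes because a piece is required to work
under every word map, and bounded distortion makes all constants uniform in the word.

Iteration gives intervals in which `F` is dense at arbitrarily small relative scales. Rescaling them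
yields the weak tangent, and counting covering balls yields the dimension. -/

theorem wordMap_append (φ : Fin N → ℝ → ℝ) (v w : List (Fin N)) (x : ℝ) :
    wordMap φ (v ++ w) x = wordMap φ v (wordMap φ w x) := by
  induction v with
  | nil => rfl
  | cons i v ih => simp [wordMap, ih]

theorem wordMap_concat (φ : Fin N → ℝ → ℝ) (v : List (Fin N)) (i : Fin N) :
    wordMap φ (v ++ [i]) = wordMap φ v ∘ φ i := by
  funext x
  rw [wordMap_append]
  rfl

/-- The convex hull of the closures of the first-level images of `Ω`. -/
def core (Ω : Set ℝ) (φ : Fin N → ℝ → ℝ) : Set ℝ :=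
  convexHull ℝ (⋃ i, closure (φ i '' Ω))

theorem isCompact_convexHull_real {s : Set ℝ} (hs : IsCompact s) : IsCompact (convexHull ℝ s) := by
  rcases s.eq_empty_or_nonempty with rfl | hne
  · simp
  have : convexHull ℝ s = Icc (sInf s) (sSup s) := by
    refine Subset.antisymm (convexHull_min (fun x hx => ?_) (convex_Icc _ _)) ?_
    · exact ⟨csInf_le hs.bddBelow hx, le_csSup hs.bddAbove hx⟩
    · exact (convex_convexHull ℝ s).ordConnected.out
        (subset_convexHull ℝ s (hs.sInf_mem hne)) (subset_convexHull ℝ s (hs.sSup_mem hne))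
  rw [this]
  exact isCompact_Icc

namespace IsConformalIFS

theorem map_mem (h : IsConformalIFS Ω φ) (i : Fin N) {x : ℝ} (hx : x ∈ Ω) : φ i x ∈ Ω :=
  h.closure_image_subset i (subset_closure ⟨x, hx, rfl⟩)

theorem core_subset (h : IsConformalIFS Ω φ) : core Ω φ ⊆ Ω :=
  convexHull_min (iUnion_subset h.closure_image_subset) h.convex

theorem isCompact_core (h : IsConformalIFS Ω φ) : IsCompact (core Ω φ) := by
  refine isCompact_convexHull_real (isCompact_iUnion fun i => ?_)
  exact Metric.isCompact_of_isClosed_isBounded isClosed_closure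
    (h.isBounded.subset (h.closure_image_subset i))

theorem map_mem_core (i : Fin N) {x : ℝ} (hx : x ∈ Ω) : φ i x ∈ core Ω φ :=
  subset_convexHull ℝ _ (mem_iUnion.2 ⟨i, subset_closure ⟨x, hx, rfl⟩⟩)

theorem wordMap_mem (h : IsConformalIFS Ω φ) (w : List (Fin N)) {x : ℝ} (hx : x ∈ Ω) :
    wordMap φ w x ∈ Ω := by
  induction w with
  | nil => exact hx
  | cons i w ih => exact h.map_mem i ih

theorem hasDerivAt (h : IsConformalIFS Ω φ) (i : Fin N) {x : ℝ} (hx : x ∈ Ω) :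
    HasDerivAt (φ i) (deriv (φ i) x) x :=
  (((h.conformal i).contDiffOn.differentiableOn one_ne_zero).differentiableAt
    (h.isOpen.mem_nhds hx)).hasDerivAt

theorem hasDerivAt_wordMap_and_ne_zero (h : IsConformalIFS Ω φ) (w : List (Fin N)) {x : ℝ}
    (hx : x ∈ Ω) :
    HasDerivAt (wordMap φ w) (deriv (wordMap φ w) x) x ∧ deriv (wordMap φ w) x ≠ 0 := by
  induction w with
  | nil => exact ⟨by simpa [wordMap] using hasDerivAt_id x, by simp [wordMap]⟩
  | cons i w ih =>
    have hc := (h.hasDerivAt i (h.wordMap_mem w hx)).comp x ih.1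
    change HasDerivAt (wordMap φ (i :: w)) _ x at hc
    refine ⟨hc.differentiableAt.hasDerivAt, ?_⟩
    rw [hc.deriv]
    exact mul_ne_zero ((h.conformal i).deriv_ne_zero _ (h.wordMap_mem w hx)) ih.2

theorem hasDerivAt_wordMap (h : IsConformalIFS Ω φ) (w : List (Fin N)) {x : ℝ} (hx : x ∈ Ω) :
    HasDerivAt (wordMap φ w) (deriv (wordMap φ w) x) x :=
  (h.hasDerivAt_wordMap_and_ne_zero w hx).1

theorem deriv_wordMap_ne_zero (h : IsConformalIFS Ω φ) (w : List (Fin N)) {x : ℝ} (hx : x ∈ Ω) :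
    deriv (wordMap φ w) x ≠ 0 :=
  (h.hasDerivAt_wordMap_and_ne_zero w hx).2

theorem deriv_wordMap_concat (h : IsConformalIFS Ω φ) (w : List (Fin N)) (i : Fin N) {x : ℝ}
    (hx : x ∈ Ω) :
    deriv (wordMap φ (w ++ [i])) x = deriv (wordMap φ w) (φ i x) * deriv (φ i) x := by
  rw [wordMap_concat]
  exact ((h.hasDerivAt_wordMap w (h.map_mem i hx)).comp x (h.hasDerivAt i hx)).deriv

theorem bddAbove_deriv (h : IsConformalIFS Ω φ) (i : Fin N) :
    BddAbove (range fun x : Ω => |deriv (φ i) x|) := by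
  rcases Ω.eq_empty_or_nonempty with rfl | ⟨y, hy⟩
  · exact ⟨0, by rintro _ ⟨⟨x, hx⟩, -⟩; exact absurd hx (notMem_empty x)⟩
  obtain ⟨α, hα, c, hc, H⟩ := (h.conformal i).holder
  obtain ⟨R, hR⟩ := Metric.isBounded_iff.1 h.isBounded
  refine ⟨|deriv (φ i) y| + c * R ^ α, ?_⟩
  rintro _ ⟨⟨x, hx⟩, rfl⟩
  have h1 := H x hx y hy
  have h2 : |x - y| ^ α ≤ R ^ α :=
    Real.rpow_le_rpow (abs_nonneg _) (by simpa [Real.dist_eq] using hR hx hy) hα.le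
  have h3 := abs_sub_abs_le_abs_sub (deriv (φ i) x) (deriv (φ i) y)
  have h4 := mul_le_mul_of_nonneg_left h2 hc.le
  dsimp only
  linarith

/-- A common contraction ratio for the maps of the system. -/
theorem exists_ratio (h : IsConformalIFS Ω φ) :
    ∃ ρ : ℝ, 0 < ρ ∧ ρ < 1 ∧ ∀ i, ∀ x ∈ Ω, |deriv (φ i) x| ≤ ρ := by
  have hN : (Finset.univ : Finset (Fin N)).Nonempty :=
    ⟨⟨0, by have := h.two_le; omega⟩, Finset.mem_univ _⟩
  obtain ⟨j, -, hj⟩ := Finset.exists_max_image Finset.univ (fun i => derivNorm Ω (φ i)) hN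
  refine ⟨max (derivNorm Ω (φ j)) (1 / 2), by positivity,
    max_lt (h.derivNorm_lt_one j) (by norm_num), fun i x hx => ?_⟩
  refine le_max_of_le_left (le_trans ?_ (hj i (Finset.mem_univ _)))
  exact le_ciSup (h.bddAbove_deriv i) ⟨x, hx⟩

theorem exists_deriv_lower_bound (h : IsConformalIFS Ω φ) :
    ∃ c : ℝ, 0 < c ∧ ∀ i, ∀ x ∈ core Ω φ, c ≤ |deriv (φ i) x| := by
  have hi : ∀ i, ∃ c : ℝ, 0 < c ∧ ∀ x ∈ core Ω φ, c ≤ |deriv (φ i) x| := by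
    intro i
    rcases (core Ω φ).eq_empty_or_nonempty with he | hne
    · exact ⟨1, one_pos, by simp [he]⟩
    have hcont : ContinuousOn (fun x => |deriv (φ i) x|) (core Ω φ) :=
      (((h.conformal i).contDiffOn.continuousOn_deriv_of_isOpen h.isOpen le_rfl).mono
        h.core_subset).abs
    obtain ⟨y, hy, hmin⟩ := h.isCompact_core.exists_isMinOn hne hcont
    exact ⟨_, abs_pos.2 ((h.conformal i).deriv_ne_zero y (h.core_subset hy)),
      fun x hx => hmin hx⟩
  choose c hc hcl using hi
  have hN : (Finset.univ : Finset (Fin N)).Nonempty :=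
    ⟨⟨0, by have := h.two_le; omega⟩, Finset.mem_univ _⟩
  obtain ⟨j, -, hj⟩ := Finset.exists_min_image Finset.univ c hN
  exact ⟨c j, hc j, fun i x hx => (hj i (Finset.mem_univ _)).trans (hcl i x hx)⟩

theorem exists_mul_deriv_wordMap (h : IsConformalIFS Ω φ) (w : List (Fin N)) {s : Set ℝ}
    (hs : Convex ℝ s) (hsΩ : s ⊆ Ω) {x y : ℝ} (hx : x ∈ s) (hy : y ∈ s) :
    ∃ ξ ∈ s, |ξ - y| ≤ |x - y| ∧
      wordMap φ w x - wordMap φ w y = deriv (wordMap φ w) ξ * (x - y) := by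
  rcases lt_trichotomy x y with hxy | rfl | hxy
  · have hsub : Icc x y ⊆ s := hs.ordConnected.out hx hy
    obtain ⟨ξ, hξ, he⟩ := exists_deriv_eq_slope (wordMap φ w) hxy
      (fun t ht => (h.hasDerivAt_wordMap w (hsΩ (hsub ht))).continuousAt.continuousWithinAt)
      (fun t ht => (h.hasDerivAt_wordMap w
        (hsΩ (hsub (Ioo_subset_Icc_self ht)))).differentiableAt.differentiableWithinAt)
    refine ⟨ξ, hsub (Ioo_subset_Icc_self hξ), ?_, ?_⟩
    · rw [abs_of_nonpos (by linarith [hξ.2]), abs_of_nonpos (by linarith)]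
      linarith [hξ.1]
    · rw [he]
      have : y - x ≠ 0 := by linarith
      field_simp
      ring
  · exact ⟨x, hx, by simp, by simp⟩
  · have hsub : Icc y x ⊆ s := hs.ordConnected.out hy hx
    obtain ⟨ξ, hξ, he⟩ := exists_deriv_eq_slope (wordMap φ w) hxy
      (fun t ht => (h.hasDerivAt_wordMap w (hsΩ (hsub ht))).continuousAt.continuousWithinAt)
      (fun t ht => (h.hasDerivAt_wordMap w
        (hsΩ (hsub (Ioo_subset_Icc_self ht)))).differentiableAt.differentiableWithinAt)
    refine ⟨ξ, hsub (Ioo_subset_Icc_self hξ), ?_, ?_⟩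
    · rw [abs_of_nonneg (by linarith [hξ.1]), abs_of_nonneg (by linarith)]
      linarith [hξ.2]
    · rw [he]
      have : x - y ≠ 0 := by linarith
      field_simp

theorem abs_deriv_wordMap_le (h : IsConformalIFS Ω φ) {ρ : ℝ}
    (hρ : ∀ i, ∀ x ∈ Ω, |deriv (φ i) x| ≤ ρ) (w : List (Fin N)) {x : ℝ} (hx : x ∈ Ω) :
    |deriv (wordMap φ w) x| ≤ ρ ^ w.length := by
  induction w using List.reverseRecOn generalizing x with
  | nil => simp [wordMap]
  | append_singleton w i ih =>
    rw [h.deriv_wordMap_concat w i hx, abs_mul, List.length_append, pow_add]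
    have h0 : 0 ≤ ρ := (abs_nonneg _).trans (hρ i x hx)
    have := ih (h.map_mem i hx)
    simpa using mul_le_mul this (hρ i x hx) (abs_nonneg _) (pow_nonneg h0 _)

theorem abs_wordMap_sub_le (h : IsConformalIFS Ω φ) {ρ : ℝ}
    (hρ : ∀ i, ∀ x ∈ Ω, |deriv (φ i) x| ≤ ρ) (w : List (Fin N)) {x y : ℝ} (hx : x ∈ Ω)
    (hy : y ∈ Ω) : |wordMap φ w x - wordMap φ w y| ≤ ρ ^ w.length * |x - y| := by
  obtain ⟨ξ, hξ, -, he⟩ := h.exists_mul_deriv_wordMap w h.convex subset_rfl hx hy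
  rw [he, abs_mul]
  exact mul_le_mul_of_nonneg_right (h.abs_deriv_wordMap_le hρ w hξ) (abs_nonneg _)

/-- Bounded distortion with a modulus of continuity. -/
theorem exists_distortion_modulus (h : IsConformalIFS Ω φ) :
    ∃ E : ℝ → ℝ, (∀ s t, 0 ≤ s → s ≤ t → E s ≤ E t) ∧ (∀ t, 0 ≤ t → 0 ≤ E t) ∧
      (∀ ε > 0, ∃ r > 0, E r ≤ ε) ∧
      ∀ w, ∀ x ∈ core Ω φ, ∀ y ∈ core Ω φ,
        |deriv (wordMap φ w) x| ≤ Real.exp (E |x - y|) * |deriv (wordMap φ w) y| := by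
  obtain ⟨ρ, hρ0, hρ1, hρ⟩ := h.exists_ratio
  obtain ⟨c₀, hc₀, hlow⟩ := h.exists_deriv_lower_bound
  choose α hα c hc H using fun i => (h.conformal i).holder
  have hθ : ∀ i, 0 < 1 - ρ ^ α i := fun i => sub_pos.2 (Real.rpow_lt_one hρ0.le hρ1 (hα i))
  have hcoef : ∀ i, 0 ≤ c i / c₀ / (1 - ρ ^ α i) :=
    fun i => div_nonneg (div_pos (hc i) hc₀).le (hθ i).le
  -- The coefficients are sums of geometric series: one letter contracts distances by `ρ` and costs
  -- a factor `exp (c i / c₀ * t ^ α i)`, and `E t - E (ρ * t)` pays for it. Summing over `i` makes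
  -- one `E` serve all letters.
  set E : ℝ → ℝ := fun t => ∑ i, c i / c₀ / (1 - ρ ^ α i) * t ^ α i with hE
  have hmono : ∀ s t, 0 ≤ s → s ≤ t → E s ≤ E t := fun s t hs hst =>
    Finset.sum_le_sum fun i _ =>
      mul_le_mul_of_nonneg_left (Real.rpow_le_rpow hs hst (hα i).le) (hcoef i)
  have hnonneg : ∀ t, 0 ≤ t → 0 ≤ E t := fun t ht =>
    Finset.sum_nonneg fun i _ => mul_nonneg (hcoef i) (Real.rpow_nonneg ht _)
  have hstep : ∀ t, 0 ≤ t → ∀ i, E (ρ * t) + c i / c₀ * t ^ α i ≤ E t := by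
    intro t ht i
    have h1 : E t - E (ρ * t) = ∑ j, c j / c₀ * t ^ α j := by
      rw [hE]
      simp only
      rw [← Finset.sum_sub_distrib]
      refine Finset.sum_congr rfl fun j _ => ?_
      rw [Real.mul_rpow hρ0.le ht]
      have := (hθ j).ne'
      field_simp
    have h2 : c i / c₀ * t ^ α i ≤ ∑ j, c j / c₀ * t ^ α j :=
      Finset.single_le_sum (f := fun j => c j / c₀ * t ^ α j)
        (fun j _ => mul_nonneg (div_pos (hc j) hc₀).le (Real.rpow_nonneg ht _))
        (Finset.mem_univ i)
    linarith
  refine ⟨E, hmono, hnonneg, ?_, ?_⟩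
  · intro ε hε
    have hcont : Continuous E := continuous_finsetSum _ fun i _ =>
      continuous_const.mul (Real.continuous_rpow_const (hα i).le)
    have h0 : E 0 = 0 := Finset.sum_eq_zero fun i _ => by
      rw [Real.zero_rpow (hα i).ne', mul_zero]
    obtain ⟨δ, hδ, hlt⟩ := Metric.continuousAt_iff.1 (hcont.continuousAt (x := 0)) ε hε
    refine ⟨δ / 2, by positivity, ?_⟩
    have := hlt (x := δ / 2) (by rw [Real.dist_eq, sub_zero, abs_of_pos (by positivity)]; linarith)
    rw [h0, Real.dist_eq, sub_zero] at this
    exact (le_abs_self _).trans this.le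
  · intro w
    induction w using List.reverseRecOn with
    | nil =>
      intro x _ y _
      simpa [wordMap] using hnonneg _ (abs_nonneg (x - y))
    | append_singleton w i ih =>
      intro x hx y hy
      have hxΩ := h.core_subset hx
      have hyΩ := h.core_subset hy
      rw [h.deriv_wordMap_concat w i hxΩ, h.deriv_wordMap_concat w i hyΩ, abs_mul, abs_mul]
      have h1 : |φ i x - φ i y| ≤ ρ * |x - y| := by
        have := h.abs_wordMap_sub_le hρ [i] hxΩ hyΩ
        simpa [wordMap] using this
      have h2 := ih _ (map_mem_core i hxΩ) _ (map_mem_core i hyΩ)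
      have h3 := hmono _ _ (abs_nonneg _) h1
      have h4 : |deriv (φ i) x| ≤ Real.exp (c i / c₀ * |x - y| ^ α i) * |deriv (φ i) y| := by
        have h5 := H i x hxΩ y hyΩ
        have h6 := abs_sub_abs_le_abs_sub (deriv (φ i) x) (deriv (φ i) y)
        have h7 := hlow i y hy
        have h8 := Real.add_one_le_exp (c i / c₀ * |x - y| ^ α i)
        have h9 : c i * |x - y| ^ α i ≤ c i / c₀ * |x - y| ^ α i * |deriv (φ i) y| := by
          have : c i * |x - y| ^ α i = c i / c₀ * |x - y| ^ α i * c₀ := by field_simp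
          rw [this]
          exact mul_le_mul_of_nonneg_left h7
            (mul_nonneg (div_pos (hc i) hc₀).le (Real.rpow_nonneg (abs_nonneg _) _))
        have := mul_le_mul_of_nonneg_right h8 (abs_nonneg (deriv (φ i) y))
        linarith
      calc |deriv (wordMap φ w) (φ i x)| * |deriv (φ i) x|
          ≤ (Real.exp (E |φ i x - φ i y|) * |deriv (wordMap φ w) (φ i y)|) *
            (Real.exp (c i / c₀ * |x - y| ^ α i) * |deriv (φ i) y|) :=
            mul_le_mul h2 h4 (abs_nonneg _) (by positivity)
        _ = Real.exp (E |φ i x - φ i y| + c i / c₀ * |x - y| ^ α i) *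
            (|deriv (wordMap φ w) (φ i y)| * |deriv (φ i) y|) := by rw [Real.exp_add]; ring
        _ ≤ _ := by
          refine mul_le_mul_of_nonneg_right (Real.exp_le_exp.2 ?_) (by positivity)
          linarith [hstep |x - y| (abs_nonneg _) i]

/-- Bounded distortion. -/
theorem exists_distortion (h : IsConformalIFS Ω φ) :
    ∃ K : ℝ, 1 ≤ K ∧ ∀ w, ∀ x ∈ core Ω φ, ∀ y ∈ core Ω φ,
      |deriv (wordMap φ w) x| ≤ K * |deriv (wordMap φ w) y| := by
  obtain ⟨E, hmono, hnonneg, -, hdist⟩ := h.exists_distortion_modulus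
  obtain ⟨R, hR⟩ := Metric.isBounded_iff.1 h.isCompact_core.isBounded
  refine ⟨Real.exp (E (max R 0)), Real.one_le_exp (hnonneg _ (le_max_right _ _)),
    fun w x hx y hy => (hdist w x hx y hy).trans ?_⟩
  refine mul_le_mul_of_nonneg_right (Real.exp_le_exp.2 (hmono _ _ (abs_nonneg _) ?_))
    (abs_nonneg _)
  exact le_max_of_le_left (by simpa [Real.dist_eq] using hR hx hy)

theorem strictMonoOn_or_strictAntiOn (h : IsConformalIFS Ω φ) (w : List (Fin N)) :
    StrictMonoOn (wordMap φ w) Ω ∨ StrictAntiOn (wordMap φ w) Ω := by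
  have hcont : ContinuousOn (wordMap φ w) Ω := fun x hx =>
    (h.hasDerivAt_wordMap w hx).continuousAt.continuousWithinAt
  rcases hasDerivWithinAt_forall_lt_or_forall_gt_of_forall_ne h.convex
    (fun x hx => (h.hasDerivAt_wordMap w hx).hasDerivWithinAt)
    (fun x hx => h.deriv_wordMap_ne_zero w hx) with hd | hd
  · exact Or.inr (strictAntiOn_of_deriv_neg h.convex hcont fun x hx => hd x (interior_subset hx))
  · exact Or.inl (strictMonoOn_of_deriv_pos h.convex hcont fun x hx => hd x (interior_subset hx))

theorem abs_wordMap_sub_add (h : IsConformalIFS Ω φ) (w : List (Fin N)) {x y z : ℝ} (hx : x ∈ Ω)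
    (hy : y ∈ Ω) (hz : z ∈ Ω) (hxyz : (x ≤ y ∧ y ≤ z) ∨ (z ≤ y ∧ y ≤ x)) :
    |wordMap φ w x - wordMap φ w z| =
      |wordMap φ w x - wordMap φ w y| + |wordMap φ w y - wordMap φ w z| := by
  have key : ∀ p q r : ℝ, (p ≤ q ∧ q ≤ r) ∨ (r ≤ q ∧ q ≤ p) → |p - r| = |p - q| + |q - r| := by
    rintro p q r (⟨h1, h2⟩ | ⟨h1, h2⟩)
    · rw [abs_of_nonpos (by linarith), abs_of_nonpos (by linarith), abs_of_nonpos (by linarith)]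
      ring
    · rw [abs_of_nonneg (by linarith), abs_of_nonneg (by linarith), abs_of_nonneg (by linarith)]
      ring
  apply key
  rcases h.strictMonoOn_or_strictAntiOn w with hm | hm
  · rcases hxyz with ⟨h1, h2⟩ | ⟨h1, h2⟩
    · exact Or.inl ⟨hm.monotoneOn hx hy h1, hm.monotoneOn hy hz h2⟩
    · exact Or.inr ⟨hm.monotoneOn hz hy h1, hm.monotoneOn hy hx h2⟩
  · rcases hxyz with ⟨h1, h2⟩ | ⟨h1, h2⟩
    · exact Or.inr ⟨hm.antitoneOn hy hz h2, hm.antitoneOn hx hy h1⟩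
    · exact Or.inl ⟨hm.antitoneOn hy hx h2, hm.antitoneOn hz hy h1⟩

theorem deriv_mul_deriv_pos (h : IsConformalIFS Ω φ) (w : List (Fin N)) {x y : ℝ} (hx : x ∈ Ω)
    (hy : y ∈ Ω) : 0 < deriv (wordMap φ w) x * deriv (wordMap φ w) y := by
  rcases hasDerivWithinAt_forall_lt_or_forall_gt_of_forall_ne h.convex
    (fun x hx => (h.hasDerivAt_wordMap w hx).hasDerivWithinAt)
    (fun x hx => h.deriv_wordMap_ne_zero w hx) with hd | hd
  · exact mul_pos_of_neg_of_neg (hd x hx) (hd y hy)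
  · exact mul_pos (hd x hx) (hd y hy)

/-- By the mean value theorem the increment uses the slope at an intermediate point. The distortion
modulus puts the ratio of slopes within `1 + ε`, uniformly in the word, and their equal signs turn
this into a bound on the difference. -/
theorem exists_uniform_linear_approx (h : IsConformalIFS Ω φ) {ε : ℝ} (hε : 0 < ε) :
    ∃ r > 0, ∀ w, ∀ x ∈ core Ω φ, ∀ y ∈ core Ω φ, |x - y| ≤ r →
      |wordMap φ w x - wordMap φ w y - deriv (wordMap φ w) y * (x - y)| ≤
        ε * |deriv (wordMap φ w) y| * |x - y| := by
  obtain ⟨E, hmono, hnonneg, hsmall, hdist⟩ := h.exists_distortion_modulus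
  obtain ⟨r, hr, hEr⟩ := hsmall (Real.log (1 + ε)) (Real.log_pos (by linarith))
  refine ⟨r, hr, fun w x hx y hy hxy => ?_⟩
  obtain ⟨ξ, hξ, hξy, he⟩ :=
    h.exists_mul_deriv_wordMap w (convex_convexHull ℝ _) h.core_subset hx hy
  rw [he, ← sub_mul, abs_mul]
  refine mul_le_mul_of_nonneg_right ?_ (abs_nonneg _)
  have hexp : Real.exp (E |ξ - y|) ≤ 1 + ε := by
    rw [← Real.exp_log (show 0 < 1 + ε by linarith)]
    exact Real.exp_le_exp.2 ((hmono _ _ (abs_nonneg _) (hξy.trans hxy)).trans hEr)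
  have h1 : |deriv (wordMap φ w) ξ| ≤ (1 + ε) * |deriv (wordMap φ w) y| :=
    (hdist w ξ hξ y hy).trans (mul_le_mul_of_nonneg_right hexp (abs_nonneg _))
  have h2 : |deriv (wordMap φ w) y| ≤ (1 + ε) * |deriv (wordMap φ w) ξ| := by
    refine (hdist w y hy ξ hξ).trans (mul_le_mul_of_nonneg_right ?_ (abs_nonneg _))
    rwa [abs_sub_comm]
  have hpos := h.deriv_mul_deriv_pos w (h.core_subset hξ) (h.core_subset hy)
  generalize deriv (wordMap φ w) ξ = p at *
  generalize deriv (wordMap φ w) y = q at *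
  have key : ∀ p q : ℝ, 0 < p → 0 < q → p ≤ (1 + ε) * q → q ≤ (1 + ε) * p → |p - q| ≤ ε * q := by
    intro p q hp hq hpq hqp
    rw [abs_le]
    constructor
    · by_contra hcon
      have : p < q := by nlinarith
      nlinarith
    · linarith
  rcases pos_and_pos_or_neg_and_neg_of_mul_pos hpos with ⟨hp, hq⟩ | ⟨hp, hq⟩
  · rw [abs_of_pos hp, abs_of_pos hq] at *
    exact key p q hp hq h1 h2
  · rw [abs_of_neg hp, abs_of_neg hq] at *
    have := key (-p) (-q) (by linarith) (by linarith) h1 h2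
    rwa [← abs_neg, show -(p - q) = -p - -q by ring]

/-- Distortion is controlled only on the core, while the norm is a supremum over `Ω`. The last
letter of a word maps `Ω` into the core, so only that letter needs separate bounds; the `1` in the
maximum covers the empty word. -/
theorem exists_derivNorm_le (h : IsConformalIFS Ω φ) :
    ∃ K : ℝ, 0 < K ∧ ∀ w, ∀ x ∈ core Ω φ,
      0 < derivNorm Ω (wordMap φ w) ∧
      derivNorm Ω (wordMap φ w) ≤ K * |deriv (wordMap φ w) x| := by
  obtain ⟨ρ, hρ0, hρ1, hρ⟩ := h.exists_ratio
  obtain ⟨c₀, hc₀, hlow⟩ := h.exists_deriv_lower_bound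
  obtain ⟨K, hK, hdist⟩ := h.exists_distortion
  refine ⟨max 1 (K / c₀), by positivity, fun w x hx => ?_⟩
  have hxΩ := h.core_subset hx
  have : Nonempty Ω := ⟨⟨x, hxΩ⟩⟩
  have hbdd : BddAbove (range fun y : Ω => |deriv (wordMap φ w) y|) := by
    refine ⟨ρ ^ w.length, ?_⟩
    rintro _ ⟨y, rfl⟩
    exact h.abs_deriv_wordMap_le hρ w y.2
  refine ⟨(abs_pos.2 (h.deriv_wordMap_ne_zero w hxΩ)).trans_le (le_ciSup hbdd ⟨x, hxΩ⟩),
    ciSup_le fun y => ?_⟩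
  rcases List.eq_nil_or_concat' w with rfl | ⟨v, i, rfl⟩
  · simp [wordMap]
  · refine le_trans ?_ (mul_le_mul_of_nonneg_right (le_max_right 1 (K / c₀)) (abs_nonneg _))
    rw [h.deriv_wordMap_concat v i y.2, h.deriv_wordMap_concat v i hxΩ, abs_mul, abs_mul]
    have h1 := hdist v _ (map_mem_core i y.2) _ (map_mem_core i hxΩ)
    have h2 := (hρ i y y.2).trans hρ1.le
    have h3 := hlow i x hx
    calc |deriv (wordMap φ v) (φ i y)| * |deriv (φ i) y|
        ≤ K * |deriv (wordMap φ v) (φ i x)| * 1 := by gcongr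
      _ = K / c₀ * (|deriv (wordMap φ v) (φ i x)| * c₀) := by field_simp
      _ ≤ _ := by gcongr

end IsConformalIFS

end Words

/-! ### Cylinders and pairs of nearby word maps -/

section Chains

variable {N : ℕ} {Ω : Set ℝ} {φ : Fin N → ℝ → ℝ} {F : Set ℝ}

/-- Bounded distortion in terms of lengths: on the core a word map is, up to `K`, a similarity whose
ratio is its derivative at any chosen point. -/
theorem IsConformalIFS.exists_abs_sub_bounds (h : IsConformalIFS Ω φ) :
    ∃ K : ℝ, 1 ≤ K ∧ ∀ w, ∀ z ∈ core Ω φ, ∀ x ∈ core Ω φ, ∀ y ∈ core Ω φ,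
      |deriv (wordMap φ w) z| * |x - y| ≤ K * |wordMap φ w x - wordMap φ w y| ∧
      |wordMap φ w x - wordMap φ w y| ≤ K * (|deriv (wordMap φ w) z| * |x - y|) := by
  obtain ⟨K, hK, hdist⟩ := h.exists_distortion
  refine ⟨K, hK, fun w z hz x hx y hy => ?_⟩
  obtain ⟨ξ, hξ, -, he⟩ :=
    h.exists_mul_deriv_wordMap w (convex_convexHull ℝ _) h.core_subset hx hy
  rw [he, abs_mul, ← mul_assoc, ← mul_assoc]
  exact ⟨mul_le_mul_of_nonneg_right (hdist w z hz ξ hξ) (abs_nonneg _),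
    mul_le_mul_of_nonneg_right (hdist w ξ hξ z hz) (abs_nonneg _)⟩

namespace IsSelfConformalSet

theorem subset_core (h : IsSelfConformalSet Ω φ F) : F ⊆ core Ω φ := by
  intro x hx
  rw [h.eq_iUnion] at hx
  obtain ⟨i, y, hy, rfl⟩ := mem_iUnion.1 hx
  exact IsConformalIFS.map_mem_core i (h.subset hy)

theorem wordMap_mem (h : IsSelfConformalSet Ω φ F) (w : List (Fin N)) {x : ℝ} (hx : x ∈ F) :
    wordMap φ w x ∈ F := by
  induction w with
  | nil => exact hx
  | cons i w ih =>
    rw [h.eq_iUnion]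
    exact mem_iUnion.2 ⟨i, _, ih, rfl⟩

theorem exists_concat (h : IsSelfConformalSet Ω φ F) {u : List (Fin N)} {z : ℝ}
    (hz : z ∈ wordMap φ u '' F) : ∃ i, z ∈ wordMap φ (u ++ [i]) '' F := by
  obtain ⟨y, hy, rfl⟩ := hz
  rw [h.eq_iUnion] at hy
  obtain ⟨i, t, ht, rfl⟩ := mem_iUnion.1 hy
  exact ⟨i, t, ht, by rw [wordMap_concat]; rfl⟩

theorem exists_word_length (h : IsSelfConformalSet Ω φ F) {z : ℝ} (hz : z ∈ F) (n : ℕ) :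
    ∃ u : List (Fin N), u.length = n ∧ z ∈ wordMap φ u '' F := by
  induction n with
  | zero => exact ⟨[], rfl, z, hz, rfl⟩
  | succ n ih =>
    obtain ⟨u, hu, hzu⟩ := ih
    obtain ⟨i, hi⟩ := h.exists_concat hzu
    exact ⟨u ++ [i], by simp [hu], hi⟩

/-- A cylinder of a fixed large level through `z` has diameter at most `r` and contains the images
of two fixed distinct points. One of these is at least half their distance away from `z`. -/
theorem exists_ne_near (h : IsSelfConformalSet Ω φ F) (hF2 : F.Nontrivial) {r : ℝ} (hr : 0 < r) :
    ∃ D > 0, ∀ z ∈ F, ∃ y ∈ F, D ≤ |y - z| ∧ |y - z| ≤ r := by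
  obtain ⟨e, he, f, hf, hef⟩ := hF2
  obtain ⟨ρ, hρ0, hρ1, hρ⟩ := h.ifs.exists_ratio
  obtain ⟨R, hR⟩ := Metric.isBounded_iff.1 h.isCompact.isBounded
  have hR' : ∀ x ∈ F, ∀ y ∈ F, |x - y| ≤ max R 1 := fun x hx y hy =>
    le_max_of_le_left (by simpa [Real.dist_eq] using hR hx hy)
  have hM : 0 < max R 1 := by positivity
  obtain ⟨n, hn⟩ := exists_pow_lt_of_lt_one (div_pos hr hM) hρ1
  obtain ⟨c₀, hc₀, hlow⟩ := h.ifs.exists_deriv_lower_bound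
  have hc : ∀ u : List (Fin N), c₀ ^ u.length * |e - f| ≤ |wordMap φ u e - wordMap φ u f| := by
    intro u
    induction u with
    | nil => simp [wordMap]
    | cons i u ih =>
      obtain ⟨ξ, hξ, -, hs⟩ := h.ifs.exists_mul_deriv_wordMap [i] (convex_convexHull ℝ _)
        h.ifs.core_subset (h.subset_core (h.wordMap_mem u he)) (h.subset_core (h.wordMap_mem u hf))
      change wordMap φ (i :: u) e - wordMap φ (i :: u) f = _ at hs
      rw [hs, abs_mul, List.length_cons, pow_succ', mul_assoc]
      exact mul_le_mul (hlow i ξ hξ) ih (by positivity) (abs_nonneg _)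
  refine ⟨c₀ ^ n * |e - f| / 2, by have := abs_pos.2 (sub_ne_zero.2 hef); positivity, ?_⟩
  intro z hz
  obtain ⟨u, hu, x, hx, rfl⟩ := h.exists_word_length hz n
  have hnear : ∀ y ∈ F, |wordMap φ u y - wordMap φ u x| ≤ r := by
    intro y hy
    have h1 := h.ifs.abs_wordMap_sub_le hρ u (h.subset hy) (h.subset hx)
    rw [hu] at h1
    have h2 := hR' y hy x hx
    rw [lt_div_iff₀ hM] at hn
    have h3 := mul_le_mul_of_nonneg_left h2 (pow_nonneg hρ0.le n)
    linarith
  have h1 := hc u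
  rw [hu] at h1
  have h2 := abs_sub_le (wordMap φ u e) (wordMap φ u x) (wordMap φ u f)
  rw [abs_sub_comm (wordMap φ u x)] at h2
  by_cases h3 : c₀ ^ n * |e - f| / 2 ≤ |wordMap φ u e - wordMap φ u x|
  · exact ⟨_, h.wordMap_mem u he, h3, hnear e he⟩
  · exact ⟨_, h.wordMap_mem u hf, by linarith, hnear f hf⟩

/-- The failure of the identity limit criterion yields pairs of words whose maps differ, but by
arbitrarily little relative to their derivatives. -/
theorem exists_close_words (h : IsSelfConformalSet Ω φ F)
    (hILC : ¬ IdentityLimitCriterion Ω φ F) {ε : ℝ} (hε : 0 < ε) :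
    ∃ v w, ∃ z ∈ F, 0 < |wordMap φ v z - wordMap φ w z| ∧
      (∀ y ∈ F, |wordMap φ v y - wordMap φ w y| ≤ |wordMap φ v z - wordMap φ w z|) ∧
      |wordMap φ v z - wordMap φ w z| ≤ ε * |deriv (wordMap φ v) z| := by
  obtain ⟨K, hK, hnorm⟩ := h.ifs.exists_derivNorm_le
  have hlt := lt_of_le_of_lt (not_lt.1 hILC) (ENNReal.ofReal_pos.2 (div_pos hε hK))
  simp only [iInf_lt_iff] at hlt
  obtain ⟨v, w, hne, hlt⟩ := hlt
  have hcont : ContinuousOn (fun x => |wordMap φ v x - wordMap φ w x|) F := fun x hx =>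
    ((h.ifs.hasDerivAt_wordMap v (h.subset hx)).continuousAt.sub
      (h.ifs.hasDerivAt_wordMap w (h.subset hx)).continuousAt).abs.continuousWithinAt
  obtain ⟨z, hz, hmax⟩ := h.isCompact.exists_isMaxOn h.nonempty hcont
  obtain ⟨hn0, hn⟩ := hnorm v z (h.subset_core hz)
  refine ⟨v, w, z, hz, ?_, fun y hy => hmax hy, ?_⟩
  · obtain ⟨y, hy⟩ := Function.ne_iff.1 hne
    exact (abs_pos.2 (sub_ne_zero.2 hy)).trans_le (hmax y.2)
  · have h1 : |wordMap φ v z - wordMap φ w z| ≤ ⨆ x : F, |wordMap φ v x - wordMap φ w x| :=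
      le_ciSup (f := fun x : F => |wordMap φ v x - wordMap φ w x|)
        ⟨_, by rintro _ ⟨x, rfl⟩; exact hmax x.2⟩ ⟨z, hz⟩
    have h2 := ENNReal.lt_ofReal_iff_toReal_lt ENNReal.ofReal_ne_top |>.1 hlt
    have h3 : (derivNorm Ω (wordMap φ v))⁻¹ * |wordMap φ v z - wordMap φ w z| ≤ ε / K := by
      refine le_trans ?_ h2.le
      exact (mul_le_mul_of_nonneg_left h1 (inv_nonneg.2 hn0.le)).trans (le_max_left _ _)
    rw [inv_mul_le_iff₀ hn0] at h3
    calc _ ≤ _ := h3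
      _ ≤ K * |deriv (wordMap φ v) z| * (ε / K) := by gcongr
      _ = _ := by field_simp

/-- If two word maps are close relative to their derivatives, then their difference varies slowly
near a point where it is maximal. -/
theorem exists_difference_variation_le (h : IsSelfConformalSet Ω φ F) (hF2 : F.Nontrivial) {M : ℝ}
    (hM : 0 < M) :
    ∃ ε > 0, ∀ v w, ∀ z ∈ F,
      (∀ y ∈ F, |wordMap φ v y - wordMap φ w y| ≤ |wordMap φ v z - wordMap φ w z|) →
      |wordMap φ v z - wordMap φ w z| ≤ ε * |deriv (wordMap φ v) z| →
      ∀ y ∈ F, |deriv (wordMap φ v) z| * |y - z| ≤ M * |wordMap φ v z - wordMap φ w z| →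
        |(wordMap φ v y - wordMap φ w y) - (wordMap φ v z - wordMap φ w z)| ≤
          |wordMap φ v z - wordMap φ w z| / 2 := by
  -- The final estimate splits `δ / 2` into two quarters: the term `10 * (η * M)` takes one, hence
  -- `η * M ≤ 1 / 40`, and `8 * (ε * M)` takes the other, hence `ε * M ≤ D / 32`. The bound `ε ≤ r /
  -- M` keeps `y` within the range of the linear approximation.
  set η : ℝ := min (1 / 2) (1 / (40 * M)) with hη
  have hη0 : 0 < η := by positivity
  have hη1 : η ≤ 1 / 2 := min_le_left _ _
  have hη2 : η * M ≤ 1 / 40 := by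
    have := min_le_right (1 / 2) (1 / (40 * M))
    calc η * M ≤ 1 / (40 * M) * M := by gcongr
      _ = 1 / 40 := by field_simp
  obtain ⟨r, hr, happrox⟩ := h.ifs.exists_uniform_linear_approx hη0
  obtain ⟨D, hD, hnear⟩ := h.exists_ne_near hF2 hr
  set ε : ℝ := min (r / M) (D / (32 * M)) with hεdef
  have hε : 0 < ε := by positivity
  have hε1 : M * ε ≤ r := by
    have := min_le_left (r / M) (D / (32 * M))
    calc M * ε ≤ M * (r / M) := by gcongr
      _ = r := by field_simp
  have hε2 : ε * M ≤ D / 32 := by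
    have := min_le_right (r / M) (D / (32 * M))
    calc ε * M ≤ D / (32 * M) * M := by gcongr
      _ = D / 32 := by field_simp
  refine ⟨ε, hε, fun v w z hz hmax hδ y hy hyz => ?_⟩
  -- A test point: the difference at `x` is at most `δ` in absolute value and `x` is at least `D`
  -- away from `z`, so the slopes at `z` cannot differ much.
  obtain ⟨x, hx, hDx, hxr⟩ := hnear z hz
  have hA : 0 < |deriv (wordMap φ v) z| :=
    abs_pos.2 (h.ifs.deriv_wordMap_ne_zero v (h.subset hz))
  have hyr : |y - z| ≤ r := by
    have h1 : |deriv (wordMap φ v) z| * |y - z| ≤ |deriv (wordMap φ v) z| * (M * ε) := by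
      calc _ ≤ _ := hyz
        _ ≤ M * (ε * |deriv (wordMap φ v) z|) := by gcongr
        _ = _ := by ring
    exact (le_of_mul_le_mul_left h1 hA).trans hε1
  have hzc := h.subset_core hz
  have hv1 := happrox v x (h.subset_core hx) z hzc hxr
  have hw1 := happrox w x (h.subset_core hx) z hzc hxr
  have hv2 := happrox v y (h.subset_core hy) z hzc hyr
  have hw2 := happrox w y (h.subset_core hy) z hzc hyr
  have hmx := hmax x hx
  generalize wordMap φ v x = vx at *
  generalize wordMap φ v y = vy at *
  generalize wordMap φ v z = vz at *
  generalize wordMap φ w x = wx at *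
  generalize wordMap φ w y = wy at *
  generalize wordMap φ w z = wz at *
  generalize deriv (wordMap φ v) z = a at *
  generalize deriv (wordMap φ w) z = b at *
  set δ := |vz - wz| with hδdef
  have hδ0 : 0 ≤ δ := abs_nonneg _
  -- the slopes at `z` are close
  have hb : |b| ≤ |a| + |a - b| := by
    have := abs_sub_abs_le_abs_sub b a
    rw [abs_sub_comm b a] at this
    linarith
  have hx0 : 0 < |x - z| := hD.trans_le hDx
  have hslope : |a - b| * |x - z| ≤ 2 * δ + η * (|a| + |b|) * |x - z| := by
    rw [← abs_mul]
    have e1 : (a - b) * (x - z) =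
        ((vx - wx) - (vz - wz)) - (vx - vz - a * (x - z)) + (wx - wz - b * (x - z)) := by ring
    rw [e1]
    have t1 := abs_add_le (((vx - wx) - (vz - wz)) - (vx - vz - a * (x - z)))
      (wx - wz - b * (x - z))
    have t2 := abs_sub ((vx - wx) - (vz - wz)) (vx - vz - a * (x - z))
    have t3 := abs_sub (vx - wx) (vz - wz)
    linarith
  have hΔ : |a - b| * D ≤ 4 * δ + 4 * η * |a| * D := by
    have h1 : (|a - b| - η * (|a| + |b|)) * |x - z| ≤ 2 * δ := by linarith
    by_cases hs : |a - b| - η * (|a| + |b|) ≤ 0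
    · have : |a - b| ≤ 4 * η * |a| := by nlinarith [abs_nonneg a, abs_nonneg (a - b)]
      nlinarith
    · push Not at hs
      have h2 : (|a - b| - η * (|a| + |b|)) * D ≤ 2 * δ :=
        (mul_le_mul_of_nonneg_left hDx hs.le).trans h1
      have h3 : |a - b| / 2 - 2 * η * |a| ≤ |a - b| - η * (|a| + |b|) := by
        nlinarith [abs_nonneg a, abs_nonneg (a - b)]
      have h4 := mul_le_mul_of_nonneg_right h3 hD.le
      linarith
  have hvar : |(vy - wy) - (vz - wz)| ≤ (2 * |a - b| + 2 * η * |a|) * |y - z| := by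
    have e1 : (vy - wy) - (vz - wz) =
        (a - b) * (y - z) + (vy - vz - a * (y - z)) - (wy - wz - b * (y - z)) := by ring
    have t1 := abs_sub ((a - b) * (y - z) + (vy - vz - a * (y - z))) (wy - wz - b * (y - z))
    have t2 := abs_add_le ((a - b) * (y - z)) (vy - vz - a * (y - z))
    rw [abs_mul] at t2
    have h3 : η * |b| * |y - z| ≤ (η * |a| + |a - b|) * |y - z| := by
      gcongr
      nlinarith [abs_nonneg (a - b)]
    rw [e1]
    linarith
  have hfin : (2 * |a - b| + 2 * η * |a|) * |y - z| * D ≤ δ / 2 * D := by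
    calc (2 * |a - b| + 2 * η * |a|) * |y - z| * D
        = (2 * (|a - b| * D) + 2 * η * |a| * D) * |y - z| := by ring
      _ ≤ (2 * (4 * δ + 4 * η * |a| * D) + 2 * η * |a| * D) * |y - z| := by gcongr
      _ ≤ (2 * (4 * (ε * |a|) + 4 * η * |a| * D) + 2 * η * |a| * D) * |y - z| := by gcongr
      _ = (8 * ε + 10 * η * D) * (|a| * |y - z|) := by ring
      _ ≤ (8 * ε + 10 * η * D) * (M * δ) := by gcongr
      _ = 8 * (ε * M) * δ + 10 * (η * M) * D * δ := by ring
      _ ≤ 8 * (D / 32) * δ + 10 * (1 / 40) * D * δ := by gcongr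
      _ = δ / 2 * D := by ring
  exact hvar.trans (le_of_mul_le_mul_right hfin hD)

/-- Each point of `F` lies in a cylinder of a prescribed size, up to a uniform constant. -/
theorem exists_cylinder (h : IsSelfConformalSet Ω φ F) :
    ∃ C : ℝ, 1 ≤ C ∧ ∀ v, ∀ z ∈ F, ∀ e ∈ F, ∀ f ∈ F, ∀ T > 0,
      T ≤ |wordMap φ v e - wordMap φ v f| →
      ∃ u, z ∈ wordMap φ u '' F ∧ T ≤ |wordMap φ (v ++ u) e - wordMap φ (v ++ u) f| ∧
        |wordMap φ (v ++ u) e - wordMap φ (v ++ u) f| ≤ C * T := by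
  obtain ⟨K, hK, hbd⟩ := h.ifs.exists_abs_sub_bounds
  obtain ⟨c₀, hc₀, hlow⟩ := h.ifs.exists_deriv_lower_bound
  obtain ⟨ρ, hρ0, hρ1, hρ⟩ := h.ifs.exists_ratio
  refine ⟨max 1 (K * K / c₀), le_max_left _ _, fun v z hz e he f hf T hT hTv => ?_⟩
  -- Otherwise every admissible `u` gives size above `C * T`. Since one more letter shrinks the size
  -- at most by `K * K / c₀`, the words can be extended forever with size at least `T`, against
  -- contraction.
  by_contra! hcon
  have hstep : ∀ (q : List (Fin N)) i, |wordMap φ q e - wordMap φ q f| ≤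
      K * K / c₀ * |wordMap φ (q ++ [i]) e - wordMap φ (q ++ [i]) f| := by
    intro q i
    obtain ⟨ξ, hξ, -, hs⟩ := h.ifs.exists_mul_deriv_wordMap [i] (convex_convexHull ℝ _)
      h.ifs.core_subset (h.subset_core he) (h.subset_core hf)
    have h1 := (hbd q e (h.subset_core he) _ (h.subset_core (h.wordMap_mem [i] he)) _
      (h.subset_core (h.wordMap_mem [i] hf))).1
    have h2 := (hbd q e (h.subset_core he) e (h.subset_core he) f (h.subset_core hf)).2
    rw [← wordMap_append, ← wordMap_append] at h1
    have h3 : c₀ * |e - f| ≤ |wordMap φ [i] e - wordMap φ [i] f| := by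
      rw [hs, abs_mul]
      exact mul_le_mul_of_nonneg_right (hlow i ξ hξ) (abs_nonneg _)
    rw [div_mul_eq_mul_div, le_div_iff₀ hc₀]
    calc |wordMap φ q e - wordMap φ q f| * c₀
        ≤ K * (|deriv (wordMap φ q) e| * |e - f|) * c₀ := by gcongr
      _ = K * (|deriv (wordMap φ q) e| * (c₀ * |e - f|)) := by ring
      _ ≤ K * (|deriv (wordMap φ q) e| * |wordMap φ [i] e - wordMap φ [i] f|) := by gcongr
      _ ≤ K * (K * |wordMap φ (q ++ [i]) e - wordMap φ (q ++ [i]) f|) := by gcongr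
      _ = _ := by ring
  have hall : ∀ n : ℕ, ∃ u : List (Fin N), u.length = n ∧ z ∈ wordMap φ u '' F ∧
      T ≤ |wordMap φ (v ++ u) e - wordMap φ (v ++ u) f| := by
    intro n
    induction n with
    | zero => exact ⟨[], rfl, ⟨z, hz, rfl⟩, by simpa using hTv⟩
    | succ n ih =>
      obtain ⟨u, hu, hzu, hTu⟩ := ih
      obtain ⟨i, hi⟩ := h.exists_concat hzu
      refine ⟨u ++ [i], by simp [hu], hi, ?_⟩
      have h1 := hcon u hzu hTu
      have h2 := hstep (v ++ u) i
      rw [List.append_assoc] at h2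
      have h3 := (h1.trans_le h2).le
      have h4 : K * K / c₀ * T ≤
          K * K / c₀ * |wordMap φ (v ++ (u ++ [i])) e - wordMap φ (v ++ (u ++ [i])) f| :=
        (mul_le_mul_of_nonneg_right (le_max_right _ _) hT.le).trans h3
      exact le_of_mul_le_mul_left h4 (by positivity)
  have hT' : 0 < T / (|e - f| + 1) := by positivity
  obtain ⟨n, hn⟩ := exists_pow_lt_of_lt_one hT' hρ1
  obtain ⟨u, hu, -, hTu⟩ := hall n
  have h1 := h.ifs.abs_wordMap_sub_le hρ (v ++ u) (h.subset he) (h.subset hf)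
  rw [lt_div_iff₀ (by positivity)] at hn
  have h2 : ρ ^ (v ++ u).length ≤ ρ ^ n :=
    pow_le_pow_of_le_one hρ0.le hρ1.le (by simp [hu])
  have h3 := mul_le_mul_of_nonneg_right h2 (abs_nonneg (e - f))
  have h4 := pow_pos hρ0 n
  nlinarith

end IsSelfConformalSet

/-- `F` has a piece which, under every word map, is dense at the scale of a reference pair of
points, while its length is at least `l` times that scale. -/
def HasDensePiece (φ : Fin N → ℝ → ℝ) (F : Set ℝ) (l : ℝ) : Prop :=
  ∃ a ∈ F, ∃ b ∈ F, ∃ e ∈ F, ∃ f ∈ F, e ≠ f ∧ ∀ q : List (Fin N),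
    l * |wordMap φ q e - wordMap φ q f| ≤ |wordMap φ q a - wordMap φ q b| ∧
    ∀ t ∈ uIcc (wordMap φ q a) (wordMap φ q b),
      ∃ p ∈ F, |t - p| ≤ |wordMap φ q e - wordMap φ q f|

namespace IsSelfConformalSet

theorem hasDensePiece_one (h : IsSelfConformalSet Ω φ F) (hF2 : F.Nontrivial) :
    HasDensePiece φ F 1 := by
  obtain ⟨e, he, f, hf, hef⟩ := hF2
  refine ⟨e, he, f, hf, e, he, f, hf, hef, fun q => ⟨by simp, fun t ht => ?_⟩⟩
  refine ⟨_, h.wordMap_mem q he, ?_⟩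
  have := abs_sub_left_of_mem_uIcc ht
  rwa [abs_sub_comm (wordMap φ q f)] at this

end IsSelfConformalSet

end Chains

/-! ### Lengthening dense pieces by nearly constant shifts -/

section Steps

variable {N : ℕ} {Ω : Set ℝ} {φ : Fin N → ℝ → ℝ} {F : Set ℝ}

/-- A set that is relatively dense in intervals at arbitrarily small relative scales. -/
def HasDenseIntervals (F : Set ℝ) : Prop :=
  ∀ l : ℝ, ∃ a b g : ℝ, 0 < g ∧ a ≤ b ∧ l * g ≤ b - a ∧ ∀ t ∈ Icc a b, ∃ p ∈ F, |t - p| ≤ g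

namespace IsSelfConformalSet

/-- The new piece runs from `φ_{vu}(m)` to `φ_{wu}(M)`, with reference pair `φ_{vu}(e)`,
`φ_{vu}(f)`. Its first part inherits density from the old piece under the word `q ++ (v ++ u)`. The
rest is a gap no longer than the reference scale, hence close to its end at `φ_{vu}(M)`. -/
theorem exists_hasDensePiece_add (h : IsSelfConformalSet Ω φ F) (hF2 : F.Nontrivial)
    (hILC : ¬ IdentityLimitCriterion Ω φ F) :
    ∃ κ > 0, ∀ l, HasDensePiece φ F l → HasDensePiece φ F (l + κ) := by
  obtain ⟨K, hK, hbd⟩ := h.ifs.exists_abs_sub_bounds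
  obtain ⟨C, hC, hcyl⟩ := h.exists_cylinder
  obtain ⟨R, hR⟩ := Metric.isBounded_iff.1 h.isCompact.isBounded
  have hR' : ∀ x ∈ F, ∀ y ∈ F, |x - y| ≤ max R 1 := fun x hx y hy =>
    le_max_of_le_left (by simpa [Real.dist_eq] using hR hx hy)
  have hR0 : 0 < max R 1 := by positivity
  generalize max R 1 = R₀ at hR' hR0
  -- The gap is at least `δ / 2`, the reference distance at most `C * (2 * K ^ 2 * δ)`, and passing
  -- to their images under `q` costs `K ^ 2`.
  refine ⟨1 / (4 * K ^ 4 * C), by positivity, ?_⟩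
  rintro l ⟨a, ha, b, hb, e, he, f, hf, hef, hq⟩
  have hef0 : 0 < |e - f| := abs_pos.2 (sub_ne_zero.2 hef)
  -- This `M` is the relative distance from `z` reached by the chosen cylinder, as computed in
  -- `hshift`.
  obtain ⟨ε, hε, hvar⟩ := h.exists_difference_variation_le hF2
    (M := 2 * K ^ 5 * C * R₀ / |e - f|) (by positivity)
  obtain ⟨v, w, z, hz, hδ0, hmax, hδ⟩ := h.exists_close_words hILC
    (ε := min ε (|e - f| / (2 * K ^ 3))) (by positivity)
  have hvar' := hvar v w z hz hmax (hδ.trans (by gcongr; exact min_le_left _ _))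
  replace hδ : |wordMap φ v z - wordMap φ w z| ≤
      |e - f| / (2 * K ^ 3) * |deriv (wordMap φ v) z| :=
    hδ.trans (by gcongr; exact min_le_right _ _)
  set δ := |wordMap φ v z - wordMap φ w z| with hδdef
  -- The threshold `2 * K ^ 2 * δ` is what lets the gap, at most `2 * δ`, stay below the reference
  -- distance after a loss of `K ^ 2` under `q`. The second bound on `ε` ensures that `v` itself
  -- starts above it.
  have hT : 2 * K ^ 2 * δ ≤ |wordMap φ v e - wordMap φ v f| := by
    have h1 := (hbd v z (h.subset_core hz) e (h.subset_core he) f (h.subset_core hf)).1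
    have h2 : K * (2 * K ^ 2 * δ) ≤ K * |wordMap φ v e - wordMap φ v f| := by
      calc K * (2 * K ^ 2 * δ)
          ≤ K * (2 * K ^ 2 * (|e - f| / (2 * K ^ 3) * |deriv (wordMap φ v) z|)) := by gcongr
        _ = |deriv (wordMap φ v) z| * |e - f| := by field_simp
        _ ≤ _ := h1
    exact le_of_mul_le_mul_left h2 (by positivity)
  obtain ⟨u, ⟨z₀, hz₀, hzu⟩, href1, href2⟩ := hcyl v z hz e he f hf _ (by positivity) hT
  have hshift : ∀ x ∈ F, |(wordMap φ (v ++ u) x - wordMap φ (w ++ u) x) -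
      (wordMap φ v z - wordMap φ w z)| ≤ δ / 2 := by
    intro x hx
    rw [wordMap_append, wordMap_append]
    refine hvar' _ (h.wordMap_mem u hx) ?_
    have h1 := (hbd v z (h.subset_core hz) _ (h.subset_core (h.wordMap_mem u hx)) z
      (h.subset_core hz)).1
    have h2 := (hbd (v ++ u) z₀ (h.subset_core hz₀) x (h.subset_core hx) z₀
      (h.subset_core hz₀)).2
    have h3 := (hbd (v ++ u) z₀ (h.subset_core hz₀) e (h.subset_core he) f (h.subset_core hf)).1
    rw [wordMap_append φ v u x, wordMap_append φ v u z₀, hzu] at h2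
    have h4 := hR' x hx z₀ hz₀
    rw [div_mul_eq_mul_div, le_div_iff₀ hef0]
    calc |deriv (wordMap φ v) z| * |wordMap φ u x - z| * |e - f|
        ≤ K * |wordMap φ v (wordMap φ u x) - wordMap φ v z| * |e - f| := by gcongr
      _ ≤ K * (K * (|deriv (wordMap φ (v ++ u)) z₀| * |x - z₀|)) * |e - f| := by gcongr
      _ = K ^ 2 * |x - z₀| * (|deriv (wordMap φ (v ++ u)) z₀| * |e - f|) := by ring
      _ ≤ K ^ 2 * R₀ * (K * |wordMap φ (v ++ u) e - wordMap φ (v ++ u) f|) := by gcongr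
      _ ≤ K ^ 2 * R₀ * (K * (C * (2 * K ^ 2 * δ))) := by gcongr
      _ = 2 * K ^ 5 * C * R₀ * δ := by ring
  -- The sign of `φ_v z - φ_w z` gives the direction of the shift. `M` is the end of the piece on
  -- that side, so the gap continues the piece outwards and the lengths add.
  obtain ⟨m, hm, M, hM, hqmM, hbetw⟩ : ∃ m ∈ F, ∃ M ∈ F,
      (∀ q : List (Fin N),
        l * |wordMap φ q e - wordMap φ q f| ≤ |wordMap φ q m - wordMap φ q M| ∧
        ∀ t ∈ uIcc (wordMap φ q m) (wordMap φ q M),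
          ∃ p ∈ F, |t - p| ≤ |wordMap φ q e - wordMap φ q f|) ∧
      ((wordMap φ (v ++ u) m ≤ wordMap φ (v ++ u) M ∧
          wordMap φ (v ++ u) M ≤ wordMap φ (w ++ u) M) ∨
        (wordMap φ (w ++ u) M ≤ wordMap φ (v ++ u) M ∧
          wordMap φ (v ++ u) M ≤ wordMap φ (v ++ u) m)) := by
    have hq' : ∀ q : List (Fin N),
        l * |wordMap φ q e - wordMap φ q f| ≤ |wordMap φ q b - wordMap φ q a| ∧
        ∀ t ∈ uIcc (wordMap φ q b) (wordMap φ q a),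
          ∃ p ∈ F, |t - p| ≤ |wordMap φ q e - wordMap φ q f| := by
      intro q
      rw [abs_sub_comm (wordMap φ q b), uIcc_comm]
      exact hq q
    have hsa := abs_le.1 (hshift a ha)
    have hsb := abs_le.1 (hshift b hb)
    rcases abs_cases (wordMap φ v z - wordMap φ w z) with ⟨hs, -⟩ | ⟨hs, -⟩ <;>
      rw [← hδdef] at hs
    · rcases le_total (wordMap φ (v ++ u) a) (wordMap φ (v ++ u) b) with hab | hab
      · exact ⟨b, hb, a, ha, hq', Or.inr ⟨by linarith, hab⟩⟩
      · exact ⟨a, ha, b, hb, hq, Or.inr ⟨by linarith, hab⟩⟩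
    · rcases le_total (wordMap φ (v ++ u) a) (wordMap φ (v ++ u) b) with hab | hab
      · exact ⟨a, ha, b, hb, hq, Or.inl ⟨hab, by linarith⟩⟩
      · exact ⟨b, hb, a, ha, hq', Or.inl ⟨hab, by linarith⟩⟩
  have hg1 : δ / 2 ≤ |wordMap φ (v ++ u) M - wordMap φ (w ++ u) M| := by
    have h1 := abs_sub_abs_le_abs_sub (wordMap φ v z - wordMap φ w z)
      (wordMap φ (v ++ u) M - wordMap φ (w ++ u) M)
    have h2 := hshift M hM
    rw [abs_sub_comm] at h2
    linarith
  have hg2 : |wordMap φ (v ++ u) M - wordMap φ (w ++ u) M| ≤ 2 * δ := by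
    have h1 := abs_sub_abs_le_abs_sub (wordMap φ (v ++ u) M - wordMap φ (w ++ u) M)
      (wordMap φ v z - wordMap φ w z)
    have h2 := hshift M hM
    linarith
  refine ⟨_, h.wordMap_mem (v ++ u) hm, _, h.wordMap_mem (w ++ u) hM, _,
    h.wordMap_mem (v ++ u) he, _, h.wordMap_mem (v ++ u) hf, ?_, fun q => ?_⟩
  · intro heq
    rw [heq, sub_self, abs_zero] at href1
    have : 0 < 2 * K ^ 2 * δ := by positivity
    linarith
  obtain ⟨hlen, hdense⟩ := hqmM (q ++ (v ++ u))
  simp only [wordMap_append φ q (v ++ u)] at hlen hdense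
  have hmem : ∀ x ∈ F, ∀ s, wordMap φ s x ∈ core Ω φ := fun x hx s =>
    h.subset_core (h.wordMap_mem s hx)
  obtain ⟨hb1, hb2⟩ := hbd q m (h.subset_core hm) _ (hmem M hM (v ++ u)) _ (hmem M hM (w ++ u))
  obtain ⟨hb3, hb4⟩ := hbd q m (h.subset_core hm) _ (hmem e he (v ++ u)) _ (hmem f hf (v ++ u))
  have hadd := h.ifs.abs_wordMap_sub_add q (h.ifs.core_subset (hmem m hm (v ++ u)))
    (h.ifs.core_subset (hmem M hM (v ++ u))) (h.ifs.core_subset (hmem M hM (w ++ u))) hbetw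
  have hqM := h.wordMap_mem q (h.wordMap_mem (v ++ u) hM)
  set A := wordMap φ (v ++ u)
  set B := wordMap φ (w ++ u)
  set d := |deriv (wordMap φ q) m|
  set ref := |A e - A f|
  set refq := |wordMap φ q (A e) - wordMap φ q (A f)|
  set g := |A M - B M|
  set gq := |wordMap φ q (A M) - wordMap φ q (B M)| with hgq
  have hd0 : 0 ≤ d := abs_nonneg _
  have hrefq0 : 0 ≤ refq := abs_nonneg _
  have hgq0 : 0 ≤ gq := abs_nonneg _
  have hupper : gq ≤ refq := by
    have h1 : 2 * δ * K ^ 2 * gq ≤ 2 * δ * K ^ 2 * refq := by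
      calc 2 * δ * K ^ 2 * gq = 2 * K ^ 2 * δ * gq := by ring
        _ ≤ ref * (K * (d * g)) := by gcongr
        _ = K * g * (d * ref) := by ring
        _ ≤ K * (2 * δ) * (K * refq) := by gcongr
        _ = _ := by ring
    exact le_of_mul_le_mul_left h1 (by positivity)
  have hlower : 1 / (4 * K ^ 4 * C) * refq ≤ gq := by
    rw [div_mul_eq_mul_div, one_mul, div_le_iff₀ (by positivity)]
    have h1 : δ / 2 * refq ≤ δ / 2 * (gq * (4 * K ^ 4 * C)) := by
      calc δ / 2 * refq ≤ g * (K * (d * ref)) := by gcongr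
        _ = K * ref * (d * g) := by ring
        _ ≤ K * (C * (2 * K ^ 2 * δ)) * (K * gq) := by gcongr
        _ = _ := by ring
    exact le_of_mul_le_mul_left h1 (by positivity)
  refine ⟨by rw [hadd, add_mul]; exact add_le_add hlen hlower, fun t ht => ?_⟩
  rcases uIcc_subset_uIcc_union_uIcc (b := wordMap φ q (A M)) ht with ht | ht
  · exact hdense t ht
  · refine ⟨_, hqM, ?_⟩
    have := abs_sub_left_of_mem_uIcc ht
    rw [abs_sub_comm (wordMap φ q (B M))] at this
    exact this.trans hupper

theorem hasDenseIntervals (h : IsSelfConformalSet Ω φ F) (hF2 : F.Nontrivial)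
    (hILC : ¬ IdentityLimitCriterion Ω φ F) : HasDenseIntervals F := by
  intro l
  obtain ⟨κ, hκ, hstep⟩ := h.exists_hasDensePiece_add hF2 hILC
  have hn : ∀ n : ℕ, HasDensePiece φ F (1 + n * κ) := by
    intro n
    induction n with
    | zero => simpa using h.hasDensePiece_one hF2
    | succ n ih =>
      have := hstep _ ih
      rwa [show 1 + (n : ℝ) * κ + κ = 1 + ((n + 1 : ℕ) : ℝ) * κ by push_cast; ring] at this
  obtain ⟨n, hnl⟩ := exists_nat_gt (l / κ)
  rw [div_lt_iff₀ hκ] at hnl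
  obtain ⟨a, -, b, -, e, -, f, -, hef, hq⟩ := hn n
  obtain ⟨h1, h2⟩ := hq []
  simp only [wordMap, id] at h1 h2
  have hef0 : 0 < |e - f| := abs_pos.2 (sub_ne_zero.2 hef)
  refine ⟨min a b, max a b, |e - f|, hef0, min_le_max, ?_, h2⟩
  rw [max_sub_min_eq_abs']
  refine le_trans ?_ h1
  gcongr
  linarith

end IsSelfConformalSet

/-! ### The weak tangent -/

theorem HasDenseIntervals.isWeakTangent (hF : HasDenseIntervals F) :
    IsWeakTangent F (Icc (-1) 1) := by
  refine ⟨subset_rfl, ?_⟩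
  choose a b g hg hab hl hd using fun n : ℕ => hF (2 * (n + 1))
  have hpos : ∀ n, 0 < (b n - a n) / 2 := fun n => by
    have : 0 < (2 * ((n : ℝ) + 1)) * g n := mul_pos (by positivity) (hg n)
    linarith [hl n]
  refine ⟨fun n => (a n + b n) / 2, fun n => (b n - a n) / 2, hpos, ?_⟩
  have hlim : Tendsto (fun n : ℕ => ENNReal.ofReal (2 * (1 / ((n : ℝ) + 1)))) atTop (𝓝 0) := by
    have := ENNReal.tendsto_ofReal
      ((tendsto_one_div_add_atTop_nhds_zero_nat (𝕜 := ℝ)).const_mul 2)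
    simpa using this
  refine tendsto_of_tendsto_of_tendsto_of_le_of_le tendsto_const_nhds hlim (fun _ => zero_le)
    fun n => ?_
  set x := (a n + b n) / 2 with hx
  set r := (b n - a n) / 2 with hr
  set η : ℝ := 1 / ((n : ℝ) + 1) with hη
  have hr0 : 0 < r := hpos n
  have hη0 : 0 < η := by positivity
  have hη1 : η ≤ 1 := by
    rw [hη, div_le_one (by positivity)]
    linarith [Nat.cast_nonneg (α := ℝ) n]
  have hgr : g n ≤ η * r := by
    rw [hη, div_mul_eq_mul_div, one_mul, le_div_iff₀ (by positivity)]
    linarith [hl n]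
  refine Metric.hausdorffEDist_le_of_mem_edist (fun t ht => ⟨t, ht.2, by simp⟩) fun t ht => ?_
  -- Pulling `t` inwards by at most `η` keeps the nearby point of the magnified set inside `[-1,
  -- 1]`; the total error is then `2 * η`.
  obtain ⟨s, hs1, hs2, hst⟩ : ∃ s, -1 + η ≤ s ∧ s ≤ 1 - η ∧ |t - s| ≤ η := by
    refine ⟨max (-1 + η) (min t (1 - η)), le_max_left _ _,
      max_le (by linarith) (min_le_right _ _), ?_⟩
    rcases le_total t (1 - η) with h1 | h1 <;> rcases le_total (-1 + η) t with h2 | h2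
    · rw [min_eq_left h1, max_eq_right h2]; simpa using hη0.le
    · rw [min_eq_left h1, max_eq_left h2, abs_le]
      constructor <;> linarith [ht.1]
    · rw [min_eq_right h1, max_eq_right (by linarith), abs_le]
      constructor <;> linarith [ht.2]
    · rw [min_eq_right h1, max_eq_right (by linarith), abs_le]
      constructor <;> linarith [ht.2]
  obtain ⟨p, hp, hsp⟩ := hd n (x + r * s) ⟨by nlinarith, by nlinarith⟩
  have hmag : |s - magnification x r p| ≤ η := by
    have h1 : s - magnification x r p = (x + r * s - p) / r := by
      rw [magnification]
      field_simp
      ring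
    rw [h1, abs_div, abs_of_pos hr0, div_le_iff₀ hr0]
    exact hsp.trans hgr
  have h2 := abs_le.1 hmag
  refine ⟨_, ⟨mem_image_of_mem _ hp, by linarith, by linarith⟩, ?_⟩
  rw [edist_dist, Real.dist_eq]
  refine ENNReal.ofReal_le_ofReal ?_
  have := abs_sub_le t s (magnification x r p)
  linarith

/-! ### The Assouad dimension -/

theorem isAssouadExponent_one (A : Set ℝ) : IsAssouadExponent A 1 := by
  classical
  refine ⟨4, by norm_num, fun x r R hr hrR => ?_⟩
  -- Cells of length `r` counted from the left end of the ball. Picking one point in each non-empty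
  -- cell puts the centres in `A`; the default `0` is filtered out.
  set c : ℝ → ℕ := fun y => ⌊(y - (x - R)) / r⌋₊ with hc
  set n : ℕ := ⌊2 * R / r⌋₊ with hn
  set cell : ℕ → Set ℝ := fun k => {y | y ∈ A ∩ Metric.closedBall x R ∧ c y = k} with hcell
  set pick : ℕ → ℝ := fun k => if hk : (cell k).Nonempty then hk.some else 0 with hpick
  have hpick_mem : ∀ k, (cell k).Nonempty → pick k ∈ cell k := fun k hk => by
    simp only [hpick, dif_pos hk]
    exact hk.some_mem
  refine ⟨((Finset.range (n + 1)).filter fun k => (cell k).Nonempty).image pick, ?_, ?_, ?_⟩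
  · intro y hy
    simp only [Finset.coe_image, mem_image, Finset.mem_coe, Finset.mem_filter] at hy
    obtain ⟨k, ⟨-, hk⟩, rfl⟩ := hy
    exact (hpick_mem k hk).1.1
  · have h1 : (((Finset.range (n + 1)).filter fun k => (cell k).Nonempty).image pick).card
        ≤ n + 1 :=
      Finset.card_image_le.trans ((Finset.card_filter_le _ _).trans (by simp))
    have h2 : (n : ℝ) ≤ 2 * R / r := Nat.floor_le (by have := hr.trans hrR; positivity)
    have h3 : 1 ≤ R / r := by rw [le_div_iff₀ hr]; linarith
    have h4 : (((((Finset.range (n + 1)).filter fun k => (cell k).Nonempty).image pick).card :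
      ℕ) : ℝ) ≤ n + 1 := by exact_mod_cast h1
    rw [NNReal.coe_one, Real.rpow_one]
    rw [mul_div_assoc] at h2
    linarith
  · intro y hy
    have hyc : y ∈ cell (c y) := ⟨hy, rfl⟩
    have hp := hpick_mem _ ⟨y, hyc⟩
    have hball : ∀ y ∈ Metric.closedBall x R, 0 ≤ (y - (x - R)) / r ∧
        (y - (x - R)) / r ≤ 2 * R / r := by
      intro y hy
      rw [Metric.mem_closedBall, Real.dist_eq, abs_le] at hy
      exact ⟨div_nonneg (by linarith) hr.le, by gcongr; linarith⟩
    simp only [mem_iUnion, Finset.mem_image, Finset.mem_filter, Finset.mem_range]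
    refine ⟨pick (c y), ⟨c y, ⟨?_, y, hyc⟩, rfl⟩, ?_⟩
    · exact Nat.lt_succ_of_le (Nat.floor_le_floor (hball y hy.2).2)
    · have e1 := Nat.floor_le (hball y hy.2).1
      have e2 := Nat.lt_floor_add_one ((y - (x - R)) / r)
      have e3 := Nat.floor_le (hball _ hp.1.2).1
      have e4 := Nat.lt_floor_add_one ((pick (c y) - (x - R)) / r)
      have e5 : ⌊(pick (c y) - (x - R)) / r⌋₊ = ⌊(y - (x - R)) / r⌋₊ := hp.2
      rw [e5] at e3 e4
      rw [Metric.mem_closedBall, Real.dist_eq]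
      have e6 : |(y - (x - R)) / r - (pick (c y) - (x - R)) / r| ≤ 1 := by
        rw [abs_le]
        constructor <;> linarith
      have e7 : (y - (x - R)) / r - (pick (c y) - (x - R)) / r = (y - pick (c y)) / r := by ring
      rw [e7, abs_div, abs_of_pos hr, div_le_one hr] at e6
      exact e6

theorem sub_le_card_mul_of_Icc_subset {a b g : ℝ} {t : Finset ℝ} (hg : 0 < g)
    (hsub : Icc a b ⊆ ⋃ y ∈ t, Metric.closedBall y g) : b - a ≤ t.card * (2 * g) := by
  have h1 := (MeasureTheory.measure_mono (μ := MeasureTheory.volume) hsub).trans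
    (MeasureTheory.measure_biUnion_finset_le t _)
  simp only [Real.volume_Icc, Real.volume_closedBall, Finset.sum_const, nsmul_eq_mul] at h1
  rw [← ENNReal.ofReal_natCast, ← ENNReal.ofReal_mul (by positivity)] at h1
  exact (ENNReal.ofReal_le_ofReal_iff (by positivity)).1 h1

/-- By length, covering at scale `g` a set that is `g`-dense in an interval of length `2 * R` takes
at least a constant times `R / g` balls. For `s < 1` this exceeds `C * (R / g) ^ s` once `R / g` is
large. -/
theorem HasDenseIntervals.one_le_of_isAssouadExponent (hF : HasDenseIntervals F) {s : ℝ≥0}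
    (hs : IsAssouadExponent F s) : 1 ≤ s := by
  by_contra! hs1
  have hs1' : 0 < 1 - (s : ℝ) := sub_pos.2 (by exact_mod_cast hs1)
  obtain ⟨C, hC, hcov⟩ := hs
  obtain ⟨X₀, hX₀⟩ := ((tendsto_rpow_atTop hs1').eventually_gt_atTop (4 * C)).exists_forall_of_atTop
  obtain ⟨a, b, g, hg, hab, hl, hd⟩ := hF (2 * max X₀ 2)
  set R := (b - a) / 2 with hR
  have hX : max X₀ 2 ≤ R / g := by
    rw [le_div_iff₀ hg]
    linarith
  have hX2 : 2 ≤ R / g := (le_max_right _ _).trans hX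
  have hgR : g < R := by
    rw [le_div_iff₀ hg] at hX2
    linarith
  obtain ⟨t, -, hcard, ht⟩ := hcov ((a + b) / 2) g R hg hgR
  -- Trimming `g` at both ends keeps the approximating points of `F` inside the covered ball;
  -- doubling the radii absorbs the approximation error.
  have hsub : Icc (a + g) (b - g) ⊆ ⋃ y ∈ t, Metric.closedBall y (2 * g) := by
    intro y hy
    obtain ⟨p, hp, hyp⟩ := hd y ⟨by linarith [hy.1], by linarith [hy.2]⟩
    have hyp' := abs_le.1 hyp
    have hpb : p ∈ Metric.closedBall ((a + b) / 2) R := by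
      rw [Metric.mem_closedBall, Real.dist_eq, abs_le]
      constructor <;> linarith [hy.1, hy.2]
    obtain ⟨q, hq, hpq⟩ := mem_iUnion₂.1 (ht ⟨hp, hpb⟩)
    refine mem_iUnion₂.2 ⟨q, hq, ?_⟩
    rw [Metric.mem_closedBall] at hpq ⊢
    have := dist_triangle y p q
    rw [Real.dist_eq y p] at this
    linarith
  have h1 := sub_le_card_mul_of_Icc_subset (by positivity) hsub
  have h2 := hX₀ (R / g) ((le_max_left _ _).trans hX)
  have hX0 : 0 < R / g := by linarith
  have h3 : (R / g) ^ (s : ℝ) * (R / g) ^ (1 - (s : ℝ)) = R / g := by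
    rw [← Real.rpow_add hX0]
    simp
  have h4 : 0 < (R / g) ^ (s : ℝ) := Real.rpow_pos_of_pos hX0 _
  have h5 : R / g ≤ 4 * C * (R / g) ^ (s : ℝ) := by
    have h6 : 2 * R - 2 * g ≤ C * (R / g) ^ (s : ℝ) * (2 * (2 * g)) := by
      have := mul_le_mul_of_nonneg_right hcard (show 0 ≤ 2 * (2 * g) by positivity)
      linarith
    have h7 : R / g * g = R := div_mul_cancel₀ R hg.ne'
    have h8 : 2 * g ≤ R := by
      rw [le_div_iff₀ hg] at hX2
      exact hX2
    have h9 : R / g * g ≤ 4 * C * (R / g) ^ (s : ℝ) * g := by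
      rw [h7]
      linarith
    exact le_of_mul_le_mul_right h9 hg
  nlinarith

theorem HasDenseIntervals.assouadDim_eq_one (hF : HasDenseIntervals F) : assouadDim F = 1 := by
  refine le_antisymm ?_ (le_iInf₂ fun s hs => ?_)
  · exact (iInf₂_le 1 (isAssouadExponent_one F)).trans (by simp)
  · exact_mod_cast hF.one_le_of_isAssouadExponent hs

end Steps

end SelfConformal

theorem theorem4p1 {N : ℕ} (Ω : Set ℝ) (φ : Fin N → ℝ → ℝ) (F : Set ℝ)
    (hF : SelfConformal.IsSelfConformalSet Ω φ F) (hF2 : F.Nontrivial)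
    (hILC : ¬ SelfConformal.IdentityLimitCriterion Ω φ F) :
    SelfConformal.IsWeakTangent F (Set.Icc (-1) 1) ∧ SelfConformal.assouadDim F = 1 := by
  have hd : SelfConformal.HasDenseIntervals F := hF.hasDenseIntervals hF2 hILC
  exact ⟨hd.isWeakTangent, hd.assouadDim_eq_one⟩
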